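/- For a complex Hilbert space $\mathcal L$ and $m\ge 1$, let $H^2_{\mathcal L}(\mathbb D^m)$ denote the $\mathcal L$-valued Hardy space over the open unit polydisc $\mathbb D^m$: the Hilbert space of functions $f(z)=\sum_{k\in\mathbb Z_+^m} z^k a_k$ with $a_k\in\mathcal L$ and $\|f\|^2=\sum_k\|a_k\|^2<\infty$, that is, the $\mathcal L$-valued reproducing kernel Hilbert space with kernel $(z,w)\mapsto\prod_{i=1}^m(1-z_i\bar w_i)^{-1}I_{\mathcal L}$. Let $n$ be a positive integer, and put $\mathcal L_n=H^2(\mathbb D^n)\otimes\mathcal L$ (Hilbert space tensor product), where $H^2(\mathbb D^n)=H^2_{\mathbb C}(\mathbb D^n)$. On $H^2_{\mathcal L_n}(\mathbb D)$ let $M_z$ be multiplication by the coordinate function, and let $M_{\kappa_i}$, $i=1,\dots,n$, be multiplication by the constant function $\kappa_i(w)=M_{z_i}\otimes I_{\mathcal L}\in\mathcal B(\mathcal L_n)$, where $M_{z_i}$ is multiplication by $z_i$ on $H^2(\mathbb D^n)$. An invariant subspace of $H^2_{\mathcal L_n}(\mathbb D)$ is a closed subspace $\mathcal S$ with $M_z\mathcal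 S\subseteq\mathcal S$ and $M_{\kappa_i}\mathcal S\subseteq\mathcal S$ for all $i$. For such $\mathcal S$ let $\mathcal W=\mathcal S\ominus z\mathcal S$ and $$\Phi_i(w)=P_{\mathcal W}\,(I_{\mathcal S}-wP_{\mathcal S}M_z^*|_{\mathcal S})^{-1}M_{\kappa_i}|_{\mathcal W}\in\mathcal B(\mathcal W)\qquad(w\in\mathbb D,\ i=1,\dots,n).$$ **Theorem 6.1.** Let $\mathcal E$ and $\tilde{\mathcal E}$ be complex Hilbert spaces, and let $\mathcal S\subseteq H^2_{\mathcal E_n}(\mathbb D)$ and $\tilde{\mathcal S}\subseteq H^2_{\tilde{\mathcal E}_n}(\mathbb D)$ be invariant subspaces, with associated $\mathcal W,\Phi_1,\dots,\Phi_n$ and $\tilde{\mathcal W},\tilde\Phi_1,\dots,\tilde\Phi_n$ respectively. Then the following are equivalent. 1. $\mathcal S$ and $\tilde{\mathcal S}$ are unitarily equivalent: there is a unitary $U:\mathcal S\to\tilde{\mathcal S}$ with $UM_z|_{\mathcal S}=M_z|_{\tilde{\mathcal S}}U$ and $UM_{\kappa_i}|_{\mathcal S}=M_{\kappa_i}|_{\tilde{\mathcal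 S}}U$ for all $i=1,\dots,n$. 2. $\{\Phi_1,\dots,\Phi_n\}$ and $\{\tilde\Phi_1,\dots,\tilde\Phi_n\}$ coincide: there is a unitary $\tau:\mathcal W\to\tilde{\mathcal W}$ with $\tau\Phi_i(z)=\tilde\Phi_i(z)\tau$ for all $z\in\mathbb D$ and $i=1,\dots,n$. Thus $\{\Phi_1,\dots,\Phi_n\}$ is a complete set of unitary invariants for invariant subspaces. -/

import Mathlib

open scoped ComplexConjugate TensorProduct Complex.UnitDisc ENNReal

noncomputable section

namespace PolydiscHardy

universe u v

/-! ## The vector-valued Hardy space over the polydisc -/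

/-- The open unit polydisc in `ℂⁿ`. -/
abbrev Polydisc (n : ℕ) : Type := {z : Fin n → ℂ // ∀ i, ‖z i‖ < 1}

/-- The monomial `z ^ k = z₁ ^ k₁ ⋯ zₙ ^ kₙ`. -/
def monomial {n : ℕ} (k : Fin n → ℕ) (z : Fin n → ℂ) : ℂ := ∏ i, z i ^ k i

theorem monomial_cons {n : ℕ} (m : ℕ) (k : Fin n → ℕ) (z : Fin (n + 1) → ℂ) :
    monomial (Fin.cons m k : Fin (n + 1) → ℕ) z = z 0 ^ m * monomial k (fun i => z i.succ) := by
  simp [monomial, Fin.prod_univ_succ]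

theorem norm_monomial {n : ℕ} (k : Fin n → ℕ) (z : Fin n → ℂ) :
    ‖monomial k z‖ = ∏ i, ‖z i‖ ^ k i := by
  simp [monomial, norm_prod]

theorem monomial_mul {n : ℕ} (k : Fin n → ℕ) (z w : Fin n → ℂ) :
    monomial k z * monomial k w = monomial k (fun i => z i * w i) := by
  simp [monomial, mul_pow, Finset.prod_mul_distrib]

theorem monomial_add_single {n : ℕ} (k : Fin n → ℕ) (i : Fin n) (z : Fin n → ℂ) :
    monomial (k + Pi.single i 1) z = z i * monomial k z := by
  have h : ∏ j, z j ^ (Pi.single i 1 : Fin n → ℕ) j = z i := by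
    rw [Finset.prod_eq_single i]
    · simp
    · intro j _ hj
      simp [Pi.single_eq_of_ne hj]
    · simp
  simp only [monomial, Pi.add_apply, pow_add, Finset.prod_mul_distrib, h]
  ring

/-- The multi-variable geometric series. -/
theorem hasSum_monomial_and_summable {n : ℕ} (z : Fin n → ℂ) (hz : ∀ i, ‖z i‖ < 1) :
    (Summable fun k : Fin n → ℕ => ‖monomial k z‖) ∧
      HasSum (fun k : Fin n → ℕ => monomial k z) (∏ i, (1 - z i)⁻¹) := by
  induction n with
  | zero =>
    refine ⟨Summable.of_finite, ?_⟩
    convert hasSum_fintype (fun k : Fin 0 → ℕ => monomial k z) using 1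
    simp [monomial]
  | succ n ih =>
    obtain ⟨h1, h2⟩ := ih (fun i => z i.succ) (fun i => hz _)
    have g1 : Summable fun m : ℕ => ‖z 0 ^ m‖ := by
      simpa using summable_geometric_of_lt_one (norm_nonneg _) (hz 0)
    have g2 := hasSum_geometric_of_norm_lt_one (hz 0)
    let e := Fin.consEquiv (fun _ : Fin (n + 1) => ℕ)
    have hs : Summable fun p : ℕ × (Fin n → ℕ) =>
        ‖z 0 ^ p.1 * monomial p.2 (fun i => z i.succ)‖ := by
      simpa using Summable.mul_of_nonneg g1 h1 (fun _ => norm_nonneg _) (fun _ => norm_nonneg _)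
    refine ⟨?_, ?_⟩
    · rw [← e.summable_iff]
      refine hs.congr ?_
      rintro ⟨m, k⟩
      exact congrArg norm (monomial_cons m k z).symm
    · rw [← e.hasSum_iff, Fin.prod_univ_succ]
      have := g2.mul h2 hs.of_norm
      refine this.congr_fun ?_
      rintro ⟨m, k⟩
      exact monomial_cons m k z

theorem summable_norm_monomial_sq {n : ℕ} (z : Polydisc n) :
    Summable fun k : Fin n → ℕ => ‖monomial k z.1‖ ^ 2 := by
  have h := (hasSum_monomial_and_summable (fun i => z.1 i * z.1 i) (fun i => by
    rw [norm_mul]; exact mul_lt_one_of_nonneg_of_lt_one_left (norm_nonneg _) (z.2 i)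
      (z.2 i).le)).1
  refine h.congr fun k => ?_
  rw [← monomial_mul, norm_mul, sq]

/-- A multi-variable power series with bounded coefficients that vanishes on the polydisc has only
zero coefficients. -/
theorem eq_zero_of_tsum_monomial_eq_zero {E : Type u} [NormedAddCommGroup E] [NormedSpace ℂ E]
    [CompleteSpace E] {n : ℕ} (a : (Fin n → ℕ) → E) (C : ℝ) (hC : ∀ k, ‖a k‖ ≤ C)
    (h : ∀ z : Polydisc n, ∑' k, monomial k z.1 • a k = 0) : a = 0 := by
  induction n with
  | zero =>
    funext k
    have h0 := h ⟨fun _ => 0, fun i => i.elim0⟩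
    rw [tsum_fintype] at h0
    simp [monomial] at h0
    exact (congrArg a (Subsingleton.elim k _)).trans h0
  | succ n ih =>
    have hC0 : 0 ≤ C := (norm_nonneg _).trans (hC 0)
    have key : ∀ m : ℕ, (fun k : Fin n → ℕ => a (Fin.cons m k : Fin (n + 1) → ℕ)) = 0 := by
      suffices H : ∀ z : Polydisc n, ∀ m : ℕ,
          ∑' k : Fin n → ℕ, monomial k z.1 • a (Fin.cons m k : Fin (n + 1) → ℕ) = 0 from
        fun m => ih _ (fun k => hC _) (fun z => H z m)
      intro z
      have hz := (hasSum_monomial_and_summable z.1 z.2).1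
      set b : ℕ → E := fun m =>
        ∑' k : Fin n → ℕ, monomial k z.1 • a (Fin.cons m k : Fin (n + 1) → ℕ) with hb
      have hbs : ∀ m, Summable fun k : Fin n → ℕ =>
          ‖monomial k z.1 • a (Fin.cons m k : Fin (n + 1) → ℕ)‖ := fun m =>
        Summable.of_nonneg_of_le (fun _ => norm_nonneg _) (fun k => by
          rw [norm_smul]; exact mul_le_mul_of_nonneg_left (hC _) (norm_nonneg _))
          (hz.mul_right C)
      have hsum0 : ∀ w : ℂ, ‖w‖ < 1 → HasSum (fun m : ℕ => w ^ m • b m) 0 := by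
        intro w hw
        let p : Polydisc (n + 1) := ⟨Fin.cons w z.1, fun i => by
          refine Fin.cases ?_ (fun j => ?_) i
          · simpa using hw
          · simpa using z.2 j⟩
        have hp := h p
        have hps : Summable fun k : Fin (n + 1) → ℕ => monomial k p.1 • a k := by
          refine Summable.of_norm (Summable.of_nonneg_of_le (fun _ => norm_nonneg _) (fun k => ?_)
            ((hasSum_monomial_and_summable p.1 p.2).1.mul_right C))
          rw [norm_smul]; exact mul_le_mul_of_nonneg_left (hC _) (norm_nonneg _)
        have hh := hps.hasSum
        rw [hp] at hh
        let e := Fin.consEquiv (fun _ : Fin (n + 1) => ℕ)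
        rw [← e.hasSum_iff] at hh
        refine hh.prod_fiberwise fun m => ?_
        have h2 := (hbs m).of_norm.hasSum.const_smul (w ^ m)
        refine h2.congr_fun fun k => ?_
        change monomial (Fin.cons m k : Fin (n + 1) → ℕ) p.1 • _ = _
        rw [monomial_cons, smul_smul]
        simp [p, e, Fin.consEquiv]
      let q : FormalMultilinearSeries ℂ ℂ E :=
        fun m => ContinuousMultilinearMap.mkPiRing ℂ (Fin m) (b m)
      have hq : ∀ m, q.coeff m = b m := fun m => by simp [q, FormalMultilinearSeries.coeff]
      have hfp : HasFPowerSeriesAt (fun _ : ℂ => (0 : E)) q 0 := by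
        rw [hasFPowerSeriesAt_iff]
        filter_upwards [Metric.ball_mem_nhds (0 : ℂ) one_pos] with w hw
        simpa only [hq] using hsum0 w (by simpa using hw)
      intro m
      have hz0 : q = 0 := hfp.eq_zero
      have hm := hq m
      rw [hz0] at hm
      change b m = 0
      rw [← hm]
      simp [FormalMultilinearSeries.coeff]
    funext k
    have := congrFun (key (k 0)) (fun i => k i.succ)
    have hk : (Fin.cons (k 0) (fun i => k i.succ) : Fin (n + 1) → ℕ) = k := Fin.cons_self_tail k
    simpa [hk] using this

/-- The `E`-valued Hardy space `H²_E(𝔻ⁿ)`: the Hilbert space of all functions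
`f(z) = ∑ₖ zᵏ aₖ` on the polydisc with `∑ₖ ‖aₖ‖² < ∞`, where `⟪f, g⟫ = ∑ₖ ⟪aₖ, bₖ⟫`.
An element is stored as its (square-summable) family of Taylor coefficients; the function it
represents is `f z`, given by the instance of `RKHS` below. -/
def HardySpace (n : ℕ) (E : Type u) [NormedAddCommGroup E] : Type u :=
  lp (fun _ : Fin n → ℕ => E) 2

section HardySpace

variable {n : ℕ} {E : Type u} [NormedAddCommGroup E]

instance : NormedAddCommGroup (HardySpace n E) :=
  inferInstanceAs (NormedAddCommGroup (lp (fun _ : Fin n → ℕ => E) 2))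

instance [InnerProductSpace ℂ E] : InnerProductSpace ℂ (HardySpace n E) :=
  inferInstanceAs (InnerProductSpace ℂ (lp (fun _ : Fin n → ℕ => E) 2))

instance [CompleteSpace E] : CompleteSpace (HardySpace n E) :=
  inferInstanceAs (CompleteSpace (lp (fun _ : Fin n → ℕ => E) 2))

namespace HardySpace

/-- The family of Taylor coefficients as an element of `ℓ²`. -/
def toLp (f : HardySpace n E) : lp (fun _ : Fin n → ℕ => E) 2 := f

/-- The `k`-th Taylor coefficient of an element of the Hardy space. -/
def coeff (f : HardySpace n E) (k : Fin n → ℕ) : E := f.toLp k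

theorem coeff_ext {f g : HardySpace n E} (h : ∀ k, f.coeff k = g.coeff k) : f = g :=
  lp.ext (funext h)

theorem coeff_add (f g : HardySpace n E) (k : Fin n → ℕ) :
    (f + g).coeff k = f.coeff k + g.coeff k := rfl

theorem summable_coeff (f : HardySpace n E) : Summable fun k => ‖f.coeff k‖ ^ 2 := by
  have := (lp.memℓp f.toLp).summable (by norm_num)
  exact this.congr fun k => by norm_cast

theorem norm_sq_eq (f : HardySpace n E) : ‖f‖ ^ 2 = ∑' k, ‖f.coeff k‖ ^ 2 := by
  have := lp.norm_rpow_eq_tsum (p := 2) (by norm_num) f.toLp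
  norm_cast at this

/-- The element of the Hardy space with a given square-summable family of Taylor coefficients. -/
def ofCoeff (a : (Fin n → ℕ) → E) (ha : Summable fun k => ‖a k‖ ^ 2) : HardySpace n E :=
  (⟨a, memℓp_gen (by norm_cast)⟩ : lp (fun _ : Fin n → ℕ => E) 2)

@[simp]
theorem coeff_ofCoeff (a : (Fin n → ℕ) → E) (ha : Summable fun k => ‖a k‖ ^ 2)
    (k : Fin n → ℕ) : (ofCoeff a ha).coeff k = a k := rfl

theorem norm_coeff_le (f : HardySpace n E) (k : Fin n → ℕ) : ‖f.coeff k‖ ≤ ‖f‖ :=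
  lp.norm_apply_le_norm (by norm_num) f.toLp k

variable [InnerProductSpace ℂ E]

theorem coeff_smul (c : ℂ) (f : HardySpace n E) (k : Fin n → ℕ) :
    (c • f).coeff k = c • f.coeff k := rfl

theorem inner_eq_tsum (f g : HardySpace n E) :
    inner ℂ f g = ∑' k, inner ℂ (f.coeff k) (g.coeff k) := rfl

theorem summable_norm_eval (f : HardySpace n E) (z : Polydisc n) :
    Summable fun k => ‖monomial k z.1 • f.coeff k‖ := by
  refine Summable.of_nonneg_of_le (fun _ => norm_nonneg _) (fun k => ?_)
    ((hasSum_monomial_and_summable z.1 z.2).1.mul_right ‖f‖)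
  rw [norm_smul]
  exact mul_le_mul_of_nonneg_left (f.norm_coeff_le k) (norm_nonneg _)

variable [CompleteSpace E]

/-- Evaluation of `f = ∑ₖ zᵏ aₖ` at a point of the polydisc. -/
def evalCLM (z : Polydisc n) : HardySpace n E →L[ℂ] E :=
  LinearMap.mkContinuous
    { toFun := fun f => ∑' k, monomial k z.1 • f.coeff k
      map_add' := fun f g => by
        simp only [coeff_add, smul_add]
        exact (summable_norm_eval f z).of_norm.tsum_add (summable_norm_eval g z).of_norm
      map_smul' := fun c f => by
        simp only [coeff_smul, RingHom.id_apply]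
        rw [← (summable_norm_eval f z).of_norm.tsum_const_smul c]
        exact tsum_congr fun k => smul_comm _ _ _ }
    (∑' k : Fin n → ℕ, ‖monomial k z.1‖) (fun f => by
      have hm := (hasSum_monomial_and_summable z.1 z.2).1
      refine (norm_tsum_le_tsum_norm (summable_norm_eval f z)).trans ?_
      rw [← tsum_mul_right]
      refine (summable_norm_eval f z).tsum_le_tsum (fun k => ?_) (hm.mul_right _)
      rw [norm_smul]
      exact mul_le_mul_of_nonneg_left (f.norm_coeff_le k) (norm_nonneg _))

/-- The Hardy space is a Hilbert space of `E`-valued functions on the polydisc with bounded point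
evaluations. -/
instance : RKHS ℂ (HardySpace n E) (Polydisc n) E where
  coeCLM := ContinuousLinearMap.pi fun z => evalCLM z
  coeCLM_injective := by
    refine (injective_iff_map_eq_zero _).mpr fun f hf => ?_
    have h0 : f.coeff = 0 := eq_zero_of_tsum_monomial_eq_zero f.coeff ‖f‖ f.norm_coeff_le
      fun z => congrFun hf z
    exact coeff_ext fun k => congrFun h0 k

theorem apply_eq_tsum (f : HardySpace n E) (z : Polydisc n) :
    f z = ∑' k, monomial k z.1 • f.coeff k := rfl

/-- The Hardy space is the reproducing kernel Hilbert space of the Szegő kernel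
`(z, w) ↦ ∏ᵢ (1 - zᵢ w̄ᵢ)⁻¹ I_E`. -/
theorem kernel_eq_szego (z w : Polydisc n) :
    RKHS.kernel (HardySpace n E) z w =
      (∏ i, (1 - z.1 i * conj (w.1 i))⁻¹) • ContinuousLinearMap.id ℂ E := by
  ext v
  have hs : Summable fun k : Fin n → ℕ => ‖conj (monomial k w.1) • v‖ ^ 2 := by
    refine ((summable_norm_monomial_sq w).mul_right (‖v‖ ^ 2)).congr fun k => ?_
    rw [norm_smul, RCLike.norm_conj, mul_pow]
  have hker : RKHS.kerFun (HardySpace n E) w v = ofCoeff _ hs := by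
    refine ext_inner_right ℂ fun f => ?_
    rw [RKHS.kerFun_inner, inner_eq_tsum, apply_eq_tsum]
    have := (innerSL ℂ v).map_tsum (summable_norm_eval f w).of_norm
    simp only [innerSL_apply_apply] at this
    rw [this]
    refine tsum_congr fun k => ?_
    simp [inner_smul_right, mul_comm]
  rw [← RKHS.kerFun_apply, hker, apply_eq_tsum]
  have hg := (hasSum_monomial_and_summable (fun i => z.1 i * conj (w.1 i)) (fun i => by
    rw [norm_mul, RCLike.norm_conj]
    exact mul_lt_one_of_nonneg_of_lt_one_left (norm_nonneg _) (z.2 i) (w.2 i).le)).2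
  have := (hg.smul_const v).tsum_eq
  simp only [smul_apply, ContinuousLinearMap.id_apply]
  rw [← this]
  refine tsum_congr fun k => ?_
  rw [coeff_ofCoeff, smul_smul]
  congr 1
  rw [← monomial_mul]
  simp [monomial, map_prod]

end HardySpace

end HardySpace

/-! ## Multiplication operators -/

section Multiplication

variable {n : ℕ} {E : Type u} [NormedAddCommGroup E]

namespace HardySpace

theorem add_single_injective (i : Fin n) :
    Function.Injective fun k : Fin n → ℕ => k + Pi.single i 1 := fun _ _ h => add_right_cancel h

/-- The Taylor coefficients of `zᵢ f`. -/
def shiftCoeff (i : Fin n) (f : HardySpace n E) (k : Fin n → ℕ) : E :=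
  if k i = 0 then 0 else f.coeff (k - Pi.single i 1)

theorem shiftCoeff_add_single (i : Fin n) (f : HardySpace n E) (k : Fin n → ℕ) :
    shiftCoeff i f (k + Pi.single i 1) = f.coeff k := by
  simp [shiftCoeff]

theorem shiftCoeff_of_notMem (i : Fin n) (f : HardySpace n E) (k : Fin n → ℕ)
    (hk : k ∉ Set.range fun k : Fin n → ℕ => k + Pi.single i 1) : shiftCoeff i f k = 0 := by
  by_contra h
  have hki : k i ≠ 0 := fun h0 => h (by simp [shiftCoeff, h0])
  refine hk ⟨k - Pi.single i 1, ?_⟩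
  funext j
  by_cases hj : j = i
  · subst hj
    simp
    omega
  · simp [Pi.single_eq_of_ne hj]

theorem hasSum_shiftCoeff_sq (i : Fin n) (f : HardySpace n E) :
    HasSum (fun k => ‖shiftCoeff i f k‖ ^ 2) (‖f‖ ^ 2) := by
  rw [← (add_single_injective i).hasSum_iff (fun k hk => by
    rw [shiftCoeff_of_notMem i f k hk]; simp), norm_sq_eq]
  refine f.summable_coeff.hasSum.congr_fun fun k => ?_
  simp [shiftCoeff_add_single]

variable [InnerProductSpace ℂ E]

/-- The operator `M_{zᵢ}` of multiplication by the coordinate function `zᵢ`. -/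
def mulCoord (i : Fin n) : HardySpace n E →ₗᵢ[ℂ] HardySpace n E where
  toFun f := ofCoeff (shiftCoeff i f) (hasSum_shiftCoeff_sq i f).summable
  map_add' f g := coeff_ext fun k => by
    by_cases hk : k i = 0 <;> simp [shiftCoeff, hk, coeff_add]
  map_smul' c f := coeff_ext fun k => by
    by_cases hk : k i = 0 <;> simp [shiftCoeff, hk, coeff_smul]
  norm_map' f := by
    refine (sq_eq_sq₀ (norm_nonneg _) (norm_nonneg _)).1 ?_
    rw [norm_sq_eq]
    exact (hasSum_shiftCoeff_sq i f).tsum_eq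

theorem mulCoord_apply [CompleteSpace E] (i : Fin n) (f : HardySpace n E) (z : Polydisc n) :
    mulCoord i f z = z.1 i • f z := by
  rw [apply_eq_tsum, apply_eq_tsum, ← (summable_norm_eval f z).of_norm.tsum_const_smul]
  refine HasSum.tsum_eq ?_
  rw [← (add_single_injective i).hasSum_iff (fun k hk => by
    change monomial k z.1 • shiftCoeff i f k = 0
    rw [shiftCoeff_of_notMem i f k hk, smul_zero])]
  refine ((summable_norm_eval f z).of_norm.const_smul (z.1 i)).hasSum.congr_fun fun k => ?_
  change monomial (k + Pi.single i 1) z.1 • shiftCoeff i f (k + Pi.single i 1) = _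
  rw [shiftCoeff_add_single, monomial_add_single, smul_smul]

/-- The operator of multiplication by the constant operator-valued function `z ↦ T`. -/
def mulConst (T : E →L[ℂ] E) : HardySpace n E →L[ℂ] HardySpace n E :=
  have hT : ∀ (f : HardySpace n E) (k : Fin n → ℕ),
      ‖T (f.coeff k)‖ ^ 2 ≤ ‖T‖ ^ 2 * ‖f.coeff k‖ ^ 2 := fun f k => by
    rw [← mul_pow]
    exact pow_le_pow_left₀ (norm_nonneg _) (T.le_opNorm _) 2
  have hs : ∀ f : HardySpace n E, Summable fun k => ‖T (f.coeff k)‖ ^ 2 := fun f =>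
    Summable.of_nonneg_of_le (fun _ => by positivity) (hT f) (f.summable_coeff.mul_left _)
  LinearMap.mkContinuous
    { toFun := fun f => ofCoeff (fun k => T (f.coeff k)) (hs f)
      map_add' := fun f g => coeff_ext fun k => by simp [coeff_add]
      map_smul' := fun c f => coeff_ext fun k => by simp [coeff_smul] }
    ‖T‖ (fun f => by
      refine (sq_le_sq₀ (norm_nonneg _) (by positivity)).1 ?_
      rw [mul_pow, norm_sq_eq, norm_sq_eq, ← tsum_mul_left]
      exact (hs f).tsum_le_tsum (hT f) (f.summable_coeff.mul_left _))

theorem mulConst_apply [CompleteSpace E] (T : E →L[ℂ] E) (f : HardySpace n E) (z : Polydisc n) :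
    mulConst T f z = T (f z) := by
  rw [apply_eq_tsum, apply_eq_tsum, T.map_tsum (summable_norm_eval f z).of_norm]
  exact tsum_congr fun k => (T.map_smul _ _).symm

end HardySpace

end Multiplication

/-! ## The tuple `(M_z, M_{κ₁}, …, M_{κₙ})` on `H²_{Eₙ}(𝔻)` -/

/-- The Hilbert space `Eₙ = H²(𝔻ⁿ) ⊗ E` (completed tensor product). -/
abbrev Fiber (n : ℕ) (E : Type u) [NormedAddCommGroup E] [InnerProductSpace ℂ E] : Type u :=
  UniformSpace.Completion (HardySpace n ℂ ⊗[ℂ] E)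

/-- The `Eₙ`-valued Hardy space `H²_{Eₙ}(𝔻)` over the disc. -/
abbrev ModelSpace (n : ℕ) (E : Type u) [NormedAddCommGroup E] [InnerProductSpace ℂ E] : Type u :=
  HardySpace 1 (Fiber n E)

section Model

variable (n : ℕ) (E : Type u) [NormedAddCommGroup E] [InnerProductSpace ℂ E]

/-- The operator `M_{zᵢ} ⊗ I_E` on `Eₙ`. -/
def fiberMul (i : Fin n) : Fiber n E →L[ℂ] Fiber n E :=
  ((HardySpace.mulCoord (E := ℂ) i).rTensor E).toContinuousLinearMap.completion

theorem fiberMul_tmul (i : Fin n) (f : HardySpace n ℂ) (η : E) :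
    fiberMul n E i ((f ⊗ₜ[ℂ] η : HardySpace n ℂ ⊗[ℂ] E) : Fiber n E) =
      ((HardySpace.mulCoord i f ⊗ₜ[ℂ] η : HardySpace n ℂ ⊗[ℂ] E) : Fiber n E) := by
  simp [fiberMul]

/-- The operator `M_z` on `H²_{Eₙ}(𝔻)`. -/
def opMz : ModelSpace n E →L[ℂ] ModelSpace n E :=
  (HardySpace.mulCoord 0).toContinuousLinearMap

/-- The operator `M_{κᵢ}` on `H²_{Eₙ}(𝔻)`, where `κᵢ` is the constant function on the disc with
value `M_{zᵢ} ⊗ I_E`. -/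
def opMκ (i : Fin n) : ModelSpace n E →L[ℂ] ModelSpace n E :=
  HardySpace.mulConst (fiberMul n E i)

/-- A (closed) invariant subspace of `H²_{Eₙ}(𝔻)` for the tuple `(M_z, M_{κ₁}, …, M_{κₙ})`. -/
structure InvariantSubspace extends Submodule ℂ (ModelSpace n E) where
  isClosed' : IsClosed (carrier : Set (ModelSpace n E))
  mapsTo_Mz : ∀ f ∈ toSubmodule, opMz n E f ∈ toSubmodule
  mapsTo_Mκ : ∀ i, ∀ f ∈ toSubmodule, opMκ n E i f ∈ toSubmodule

end Model

namespace InvariantSubspace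

variable {n : ℕ} {E : Type u} [NormedAddCommGroup E] [InnerProductSpace ℂ E]
variable (S : InvariantSubspace n E)

instance : CompleteSpace S.toSubmodule := S.isClosed'.completeSpace_coe

/-- The restriction `M_z|_S`, as an operator on `S`. -/
def restrictMz : S.toSubmodule →L[ℂ] S.toSubmodule :=
  ((opMz n E).comp S.toSubmodule.subtypeL).codRestrict S.toSubmodule
    fun f => S.mapsTo_Mz f.1 f.2

/-- The restriction `M_{κᵢ}|_S`, as an operator on `S`. -/
def restrictMκ (i : Fin n) : S.toSubmodule →L[ℂ] S.toSubmodule :=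
  ((opMκ n E i).comp S.toSubmodule.subtypeL).codRestrict S.toSubmodule
    fun f => S.mapsTo_Mκ i f.1 f.2

/-- The wandering subspace `W = S ⊖ zS`, as a subspace of `S`. -/
def wandering : Submodule ℂ S.toSubmodule := (S.restrictMz.range)ᗮ

instance : CompleteSpace S.wandering :=
  (Submodule.isClosed_orthogonal _).completeSpace_coe

/-- The operator `P_S M_z^*|_S` on `S`. -/
def compressMzAdjoint : S.toSubmodule →L[ℂ] S.toSubmodule :=
  S.toSubmodule.orthogonalProjectionOnto ∘L (ContinuousLinearMap.adjoint (opMz n E)) ∘L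
    S.toSubmodule.subtypeL

theorem norm_compressMzAdjoint_le : ‖S.compressMzAdjoint‖ ≤ 1 := by
  refine ContinuousLinearMap.opNorm_le_bound _ zero_le_one fun f => ?_
  have h1 : ‖ContinuousLinearMap.adjoint (opMz n E)‖ ≤ 1 := by
    rw [LinearIsometryEquiv.norm_map]
    exact LinearIsometry.norm_toContinuousLinearMap_le _
  have h2 := S.toSubmodule.orthogonalProjectionOnto_norm_le
  calc ‖S.compressMzAdjoint f‖
      ≤ ‖S.toSubmodule.orthogonalProjectionOnto‖ *
          ‖ContinuousLinearMap.adjoint (opMz n E) (f : ModelSpace n E)‖ :=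
        S.toSubmodule.orthogonalProjectionOnto.le_opNorm _
    _ ≤ 1 * (1 * ‖f‖) := by
        refine mul_le_mul h2 ?_ (norm_nonneg _) zero_le_one
        exact ContinuousLinearMap.le_of_opNorm_le _ h1 _
    _ = 1 * ‖f‖ := by ring

/-- For `w` in the disc, `I_S - w P_S M_z^*` is invertible, so that `Ring.inverse` below is its
genuine inverse. -/
theorem isUnit_one_sub_smul (w : 𝔻) : IsUnit (1 - (w : ℂ) • S.compressMzAdjoint) := by
  refine isUnit_one_sub_of_norm_lt_one (x := (w : ℂ) • S.compressMzAdjoint) ?_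
  refine (ContinuousLinearMap.opNorm_smul_le _ _).trans_lt ?_
  exact mul_lt_one_of_nonneg_of_lt_one_left (norm_nonneg _) w.norm_lt_one
    S.norm_compressMzAdjoint_le

/-- The multiplier `Φᵢ(w) = P_W (I_S - w P_S M_z^*)⁻¹ M_{κᵢ}|_W`, for `w` in the disc. -/
def multiplier (i : Fin n) (w : 𝔻) : S.wandering →L[ℂ] S.wandering :=
  S.wandering.orthogonalProjectionOnto ∘L
    Ring.inverse (1 - (w : ℂ) • S.compressMzAdjoint) ∘L
      S.restrictMκ i ∘L S.wandering.subtypeL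

/-- `S` and `T` are unitarily equivalent: some unitary `U : S → T` intertwines the restrictions of
the two tuples `(M_z, M_{κ₁}, …, M_{κₙ})`. -/
def UnitarilyEquivalent {F : Type v} [NormedAddCommGroup F] [InnerProductSpace ℂ F]
    (S : InvariantSubspace n E) (T : InvariantSubspace n F) : Prop :=
  ∃ U : S.toSubmodule ≃ₗᵢ[ℂ] T.toSubmodule,
    (∀ f, U (S.restrictMz f) = T.restrictMz (U f)) ∧
      ∀ i f, U (S.restrictMκ i f) = T.restrictMκ i (U f)

end InvariantSubspace

/-- Two families of operator-valued functions on the disc coincide if a single (constant) unitary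
operator intertwines them pointwise. -/
def Coincide {n : ℕ} {W : Type u} [NormedAddCommGroup W] [InnerProductSpace ℂ W]
    {W' : Type v} [NormedAddCommGroup W'] [InnerProductSpace ℂ W']
    (Ψ : Fin n → 𝔻 → W →L[ℂ] W) (Ψ' : Fin n → 𝔻 → W' →L[ℂ] W') : Prop :=
  ∃ τ : W ≃ₗᵢ[ℂ] W', ∀ (i : Fin n) (z : 𝔻) (x : W), τ (Ψ i z x) = Ψ' i z (τ x)

end PolydiscHardy

end

/-!
Write `V = M_z|_S` and `Kᵢ = M_{κᵢ}|_S`. Everything rests on the moments `⟪Vᵏ y, Kᵢ x⟫` with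
`x, y` in the wandering subspace `W`. Since `P_S M_z^*|_S = V^*`, the Neumann series of
`(1 - z V^*)⁻¹` gives `⟪y, Φᵢ(z) x⟫ = ∑ₖ zᵏ ⟪Vᵏ y, Kᵢ x⟫` (`hasSum_inner_multiplier`), so a unitary
`τ : W → W'` intertwines the multipliers if and only if it preserves all moments
(`intertwines_multiplier_iff`).

A unitary equivalence maps wandering subspace onto wandering subspace, and its restriction clearly
preserves the moments. Conversely, `V` is an isometry with `⋂ₖ Vᵏ S = 0`, because the Taylor
coefficients of `zᵏ f` of degree less than `k` vanish. By the Wold decomposition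
(`isHilbertSum_wandering`) `S` is the Hilbert sum of the subspaces `Vᵏ W`, so that any unitary `τ`
between the wandering subspaces extends to a unitary `U` with `U (Vᵏ x) = V'ᵏ (τ x)`; this `U`
intertwines `V` and `V'`. As `Kᵢ` commutes with `V`, it is determined by its values on `W`, and
these are determined by the moments; hence `U` intertwines `Kᵢ` and `Kᵢ'` as soon as `τ` preserves
the moments (`exists_linearIsometryEquiv_intertwining`).
-/

namespace PolydiscHardy

/-! ### Inner products on subspaces -/

/-- `LinearIsometryEquiv.inner_map_map` for subspaces. In a general ambient space the two instance
paths to the norm of a subspace unify immediately, whereas for subspaces of `S.toSubmodule` Lean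
would unfold the Hardy space. -/
theorem inner_map_map_submodule {H H' : Type*} [NormedAddCommGroup H] [InnerProductSpace ℂ H]
    [NormedAddCommGroup H'] [InnerProductSpace ℂ H'] {W : Submodule ℂ H} {W' : Submodule ℂ H'}
    (τ : W ≃ₗᵢ[ℂ] W') (x y : W) : inner ℂ (τ x) (τ y) = inner ℂ x y :=
  LinearIsometryEquiv.inner_map_map τ x y

/-! ### The Wold decomposition of a pure isometry -/

section Wold

variable {H : Type*} [NormedAddCommGroup H] [InnerProductSpace ℂ H]

theorem orthogonalFamily_wandering (V : H →ₗᵢ[ℂ] H) :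
    OrthogonalFamily ℂ (fun _ : ℕ => ↥(V.toLinearMap.rangeᗮ))
      (fun k => (V ^ k).comp (V.toLinearMap.rangeᗮ).subtypeₗᵢ) := by
  have key : ∀ (i d : ℕ) (x y : ↥(V.toLinearMap.rangeᗮ)),
      inner ℂ ((V ^ i) (x : H)) ((V ^ (i + (d + 1))) (y : H)) = 0 := by
    intro i d x y
    rw [pow_add, LinearIsometry.coe_mul, Function.comp_apply, LinearIsometry.inner_map_map, pow_succ',
      LinearIsometry.coe_mul, Function.comp_apply]
    exact Submodule.inner_left_of_mem_orthogonal (LinearMap.mem_range_self _ _) x.2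
  intro i j hij x y
  rcases lt_or_gt_of_ne hij with h | h
  · obtain ⟨d, rfl⟩ := Nat.exists_eq_add_of_lt h
    exact key i d x y
  · obtain ⟨d, rfl⟩ := Nat.exists_eq_add_of_lt h
    exact inner_eq_zero_symm.1 (key j d y x)

variable [CompleteSpace H]

/-- For a pure isometry `V`, a vector orthogonal to every `Vᵏ W` is zero: it lies in the range of
every power of `V`. -/
theorem eq_zero_of_forall_inner_pow_wandering (V : H →ₗᵢ[ℂ] H)
    (hV : ∀ x, (∀ k : ℕ, ∃ y, (V ^ k) y = x) → x = 0) (x : H)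
    (hx : ∀ (k : ℕ) (w : ↥(V.toLinearMap.rangeᗮ)), inner ℂ ((V ^ k) (w : H)) x = 0) : x = 0 := by
  refine hV x fun k => ?_
  induction k with
  | zero => exact ⟨x, rfl⟩
  | succ k ih =>
    obtain ⟨y, rfl⟩ := ih
    have hcl : IsClosed (V.toLinearMap.range : Set H) := by
      have := V.isometry.isClosedEmbedding.isClosed_range
      simpa [LinearMap.coe_range] using this
    have : CompleteSpace V.toLinearMap.range := hcl.completeSpace_coe
    have hy : y ∈ V.toLinearMap.rangeᗮᗮ := by
      refine (Submodule.mem_orthogonal _ _).2 fun w hw => ?_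
      simpa using hx k ⟨w, hw⟩
    rw [Submodule.orthogonal_orthogonal] at hy
    obtain ⟨v, rfl⟩ := hy
    exact ⟨v, by rw [pow_succ]; rfl⟩

theorem isHilbertSum_wandering (V : H →ₗᵢ[ℂ] H)
    (hV : ∀ x, (∀ k : ℕ, ∃ y, (V ^ k) y = x) → x = 0)
    {G : Type*} [NormedAddCommGroup G] [InnerProductSpace ℂ G] [CompleteSpace G]
    (τ : G ≃ₗᵢ[ℂ] ↥(V.toLinearMap.rangeᗮ)) :
    IsHilbertSum ℂ (fun _ : ℕ => G)
      (fun k => ((V ^ k).comp (V.toLinearMap.rangeᗮ).subtypeₗᵢ).comp τ.toLinearIsometry) := by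
  refine IsHilbertSum.mk (fun i j hij x y => orthogonalFamily_wandering V hij (τ x) (τ y)) ?_
  rw [top_le_iff, Submodule.topologicalClosure_eq_top_iff, Submodule.eq_bot_iff]
  refine fun x hx => eq_zero_of_forall_inner_pow_wandering V hV x fun k w => ?_
  refine Submodule.inner_right_of_mem_orthogonal ?_ hx
  refine Submodule.mem_iSup_of_mem k ⟨τ.symm w, ?_⟩
  simp

/-- A unitary between the wandering subspaces of two pure isometries extends to a unitary of the
whole spaces that respects the Wold decompositions. -/
theorem exists_linearIsometryEquiv_extending {H' : Type*} [NormedAddCommGroup H']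
    [InnerProductSpace ℂ H'] [CompleteSpace H'] (V : H →ₗᵢ[ℂ] H) (V' : H' →ₗᵢ[ℂ] H')
    (hV : ∀ x, (∀ k : ℕ, ∃ y, (V ^ k) y = x) → x = 0)
    (hV' : ∀ x, (∀ k : ℕ, ∃ y, (V' ^ k) y = x) → x = 0)
    (τ : ↥(V.toLinearMap.rangeᗮ) ≃ₗᵢ[ℂ] ↥(V'.toLinearMap.rangeᗮ)) :
    ∃ U : H ≃ₗᵢ[ℂ] H', ∀ (k : ℕ) (x : ↥(V.toLinearMap.rangeᗮ)),
      U ((V ^ k) (x : H)) = (V' ^ k) (τ x : H') := by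
  have : CompleteSpace ↥(V.toLinearMap.rangeᗮ) :=
    (Submodule.isClosed_orthogonal _).completeSpace_coe
  have h := isHilbertSum_wandering V hV (LinearIsometryEquiv.refl ℂ ↥(V.toLinearMap.rangeᗮ))
  have h' := isHilbertSum_wandering V' hV' τ
  refine ⟨h.linearIsometryEquiv.trans h'.linearIsometryEquiv.symm, fun k x => ?_⟩
  have e := h.linearIsometryEquiv_symm_apply_single (i := k) x
  have e' := h'.linearIsometryEquiv_symm_apply_single (i := k) x
  change h'.linearIsometryEquiv.symm (h.linearIsometryEquiv ((V ^ k) (x : H))) = _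
  have e2 : h.linearIsometryEquiv ((V ^ k) (x : H)) = lp.single 2 k x := by
    rw [← LinearIsometryEquiv.apply_symm_apply h.linearIsometryEquiv (lp.single 2 k x), e]
    rfl
  rw [e2, e']
  rfl

/-- Continuous linear maps that agree on every `Vᵏ W` are equal. -/
theorem ext_pow_wandering {F : Type*} [NormedAddCommGroup F] [NormedSpace ℂ F] (V : H →ₗᵢ[ℂ] H)
    (hV : ∀ x, (∀ k : ℕ, ∃ y, (V ^ k) y = x) → x = 0) {f g : H →L[ℂ] F}
    (h : ∀ (k : ℕ) (x : ↥(V.toLinearMap.rangeᗮ)), f ((V ^ k) (x : H)) = g ((V ^ k) (x : H))) :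
    f = g := by
  rw [← sub_eq_zero]
  set N : Submodule ℂ H := (f - g).ker
  have : CompleteSpace N := (f - g).isClosed_ker.completeSpace_coe
  have hN : N = ⊤ := by
    rw [← Submodule.orthogonal_eq_bot_iff, Submodule.eq_bot_iff]
    refine fun x hx => eq_zero_of_forall_inner_pow_wandering V hV x fun k w => ?_
    refine Submodule.inner_right_of_mem_orthogonal ?_ hx
    simp [N, h k w]
  ext x
  have : x ∈ N := hN ▸ Submodule.mem_top
  simpa [N] using this

/-- A unitary `τ` between wandering subspaces extends to a unitary intertwining the pure isometries
and the operators that commute with them, provided that `τ` preserves the moments. -/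
theorem exists_linearIsometryEquiv_intertwining {H' : Type*} [NormedAddCommGroup H']
    [InnerProductSpace ℂ H'] [CompleteSpace H'] (V : H →ₗᵢ[ℂ] H) (V' : H' →ₗᵢ[ℂ] H')
    (hV : ∀ x, (∀ k : ℕ, ∃ y, (V ^ k) y = x) → x = 0)
    (hV' : ∀ x, (∀ k : ℕ, ∃ y, (V' ^ k) y = x) → x = 0)
    {ι : Type*} (K : ι → H →L[ℂ] H) (K' : ι → H' →L[ℂ] H')
    (hK : ∀ i k x, K i ((V ^ k) x) = (V ^ k) (K i x))
    (hK' : ∀ i k x, K' i ((V' ^ k) x) = (V' ^ k) (K' i x))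
    (τ : ↥(V.toLinearMap.rangeᗮ) ≃ₗᵢ[ℂ] ↥(V'.toLinearMap.rangeᗮ))
    (hτ : ∀ i (x y : ↥(V.toLinearMap.rangeᗮ)) (k : ℕ),
      inner ℂ ((V ^ k) (y : H)) (K i x) = inner ℂ ((V' ^ k) (τ y : H')) (K' i (τ x))) :
    ∃ U : H ≃ₗᵢ[ℂ] H', (∀ x, U (V x) = V' (U x)) ∧ ∀ i x, U (K i x) = K' i (U x) := by
  obtain ⟨U, hU⟩ := exists_linearIsometryEquiv_extending V V' hV hV' τ
  have hU0 : ∀ x : ↥(V.toLinearMap.rangeᗮ), U (x : H) = (τ x : H') := hU 0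
  have hz : ∀ x, U (V x) = V' (U x) := by
    refine DFunLike.congr_fun (ext_pow_wandering V hV
      (f := (U.toContinuousLinearEquiv : H →L[ℂ] H') ∘L V.toContinuousLinearMap)
      (g := V'.toContinuousLinearMap ∘L (U.toContinuousLinearEquiv : H →L[ℂ] H')) fun k x => ?_)
    change U (V ((V ^ k) (x : H))) = V' (U ((V ^ k) (x : H)))
    have e : V ((V ^ k) (x : H)) = (V ^ (k + 1)) (x : H) := by
      rw [pow_succ', LinearIsometry.coe_mul, Function.comp_apply]
    rw [hU, e, hU, pow_succ', LinearIsometry.coe_mul, Function.comp_apply]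
  have hzk : ∀ (k : ℕ) x, U ((V ^ k) x) = (V' ^ k) (U x) := by
    intro k x
    induction k with
    | zero => rfl
    | succ k ih =>
      rw [pow_succ', pow_succ', LinearIsometry.coe_mul, LinearIsometry.coe_mul,
        Function.comp_apply, Function.comp_apply, hz, ih]
  -- On the wandering subspace, `U (Kᵢ x)` and `Kᵢ' (τ x)` have the same Wold components.
  have hW : ∀ i (x : ↥(V.toLinearMap.rangeᗮ)), U (K i x) = K' i (τ x) := by
    intro i x
    rw [← sub_eq_zero]
    refine eq_zero_of_forall_inner_pow_wandering V' hV' _ fun k w => ?_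
    obtain ⟨y, rfl⟩ := τ.surjective w
    rw [inner_sub_right, sub_eq_zero, ← hτ, ← hU, U.inner_map_map]
  refine ⟨U, hz, fun i => DFunLike.congr_fun (ext_pow_wandering V hV
    (f := (U.toContinuousLinearEquiv : H →L[ℂ] H') ∘L K i)
    (g := K' i ∘L (U.toContinuousLinearEquiv : H →L[ℂ] H')) fun k x => ?_)⟩
  change U (K i ((V ^ k) (x : H))) = K' i (U ((V ^ k) (x : H)))
  rw [hK, hzk, hzk, hK', hW, hU0]

end Wold

/-! ### Power series on the disc -/

theorem eq_of_hasSum_pow_mul {a b : ℕ → ℂ} {s : Complex.UnitDisc → ℂ}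
    (ha : ∀ z : Complex.UnitDisc, HasSum (fun k => (z : ℂ) ^ k * a k) (s z))
    (hb : ∀ z : Complex.UnitDisc, HasSum (fun k => (z : ℂ) ^ k * b k) (s z)) : a = b := by
  let q : FormalMultilinearSeries ℂ ℂ ℂ :=
    fun k => ContinuousMultilinearMap.mkPiRing ℂ (Fin k) (a k - b k)
  have hq : ∀ k, q.coeff k = a k - b k := fun k => by simp [q, FormalMultilinearSeries.coeff]
  have hfp : HasFPowerSeriesAt (fun _ : ℂ => (0 : ℂ)) q 0 := by
    rw [hasFPowerSeriesAt_iff]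
    filter_upwards [Metric.ball_mem_nhds (0 : ℂ) one_pos] with w hw
    have hw1 : ‖w‖ < 1 := by simpa using hw
    have := (ha (Complex.UnitDisc.mk w hw1)).sub (hb (Complex.UnitDisc.mk w hw1))
    simpa [hq, mul_sub] using this
  funext k
  have hk := hq k
  rw [hfp.eq_zero] at hk
  exact sub_eq_zero.1 (hk.symm.trans (by simp [FormalMultilinearSeries.coeff]))

/-- The Neumann series of the resolvent of a contraction, in weak form. -/
theorem hasSum_inner_inverse_one_sub_smul {H : Type*} [NormedAddCommGroup H]
    [InnerProductSpace ℂ H] [CompleteSpace H] (A : H →L[ℂ] H) (hA : ‖A‖ ≤ 1)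
    (z : Complex.UnitDisc) (x y : H) :
    HasSum (fun k : ℕ => (z : ℂ) ^ k * inner ℂ y ((A ^ k) x))
      (inner ℂ y (Ring.inverse (1 - (z : ℂ) • A) x)) := by
  have hlt : ‖(z : ℂ) • A‖ < 1 := (ContinuousLinearMap.opNorm_smul_le _ _).trans_lt
    (mul_lt_one_of_nonneg_of_lt_one_left (norm_nonneg _) z.norm_lt_one hA)
  have h1 : HasSum (fun k : ℕ => ((z : ℂ) • A) ^ k) (Ring.inverse (1 - (z : ℂ) • A)) := by
    rw [NormedRing.inverse_one_sub _ hlt]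
    exact (summable_geometric_of_norm_lt_one hlt).hasSum
  have h2 := (h1.mapL (ContinuousLinearMap.apply ℂ H x)).mapL (innerSL ℂ y)
  refine h2.congr_fun fun k => ?_
  change _ = inner ℂ y ((((z : ℂ) • A) ^ k) x)
  rw [smul_pow]
  exact (inner_smul_right _ _ _).symm

/-! ### The shift on an invariant subspace -/

namespace InvariantSubspace

variable {n : ℕ} {E : Type*} [NormedAddCommGroup E] [InnerProductSpace ℂ E]
variable (S : InvariantSubspace n E)

/-- The restriction `M_z|_S` as a linear isometry. -/
noncomputable def shift : S.toSubmodule →ₗᵢ[ℂ] S.toSubmodule where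
  toLinearMap := S.restrictMz.toLinearMap
  norm_map' f := (HardySpace.mulCoord (E := Fiber n E) (0 : Fin 1)).norm_map (f : ModelSpace n E)

theorem coeff_shift_pow_of_lt (k : ℕ) (f : S.toSubmodule) (m : Fin 1 → ℕ) (hm : m 0 < k) :
    HardySpace.coeff ((S.shift ^ k) f : ModelSpace n E) m = 0 := by
  induction k generalizing m with
  | zero => omega
  | succ k ih =>
    rw [pow_succ']
    change HardySpace.shiftCoeff 0 ((S.shift ^ k) f : ModelSpace n E) m = 0
    unfold HardySpace.shiftCoeff
    split_ifs with h
    · rfl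
    · exact ih _ (by simp; omega)

theorem shift_pure (f : S.toSubmodule) (hf : ∀ k : ℕ, ∃ g, (S.shift ^ k) g = f) : f = 0 := by
  refine Subtype.ext (HardySpace.coeff_ext fun m => ?_)
  obtain ⟨g, rfl⟩ := hf (m 0 + 1)
  exact S.coeff_shift_pow_of_lt _ g m (Nat.lt_succ_self _)

theorem restrictMκ_shift (i : Fin n) (f : S.toSubmodule) :
    S.restrictMκ i (S.shift f) = S.shift (S.restrictMκ i f) := by
  refine Subtype.ext (HardySpace.coeff_ext fun m => ?_)
  change fiberMul n E i (HardySpace.shiftCoeff 0 (f : ModelSpace n E) m) =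
    HardySpace.shiftCoeff 0 (HardySpace.mulConst (fiberMul n E i) (f : ModelSpace n E)) m
  unfold HardySpace.shiftCoeff
  split_ifs
  · exact map_zero _
  · rfl

theorem restrictMκ_shift_pow (i : Fin n) (k : ℕ) (f : S.toSubmodule) :
    S.restrictMκ i ((S.shift ^ k) f) = (S.shift ^ k) (S.restrictMκ i f) := by
  induction k with
  | zero => rfl
  | succ k ih => rw [pow_succ', LinearIsometry.coe_mul, Function.comp_apply, restrictMκ_shift, ih]; rfl

theorem inner_compressMzAdjoint (f g : S.toSubmodule) :
    inner ℂ f (S.compressMzAdjoint g) = inner ℂ (S.shift f) g := by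
  change inner ℂ f (S.toSubmodule.orthogonalProjectionOnto
    (ContinuousLinearMap.adjoint (opMz n E) (g : ModelSpace n E))) = _
  rw [Submodule.inner_orthogonalProjectionOnto_eq_of_mem_left,
    ContinuousLinearMap.adjoint_inner_right]
  rfl

theorem inner_compressMzAdjoint_pow (k : ℕ) (f g : S.toSubmodule) :
    inner ℂ f ((S.compressMzAdjoint ^ k) g) = inner ℂ ((S.shift ^ k) f) g := by
  induction k generalizing g with
  | zero => rfl
  | succ k ih =>
    rw [pow_succ, pow_succ']
    exact (ih _).trans (S.inner_compressMzAdjoint _ _)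

/-! ### Moments of the multipliers -/

/-- The Taylor expansion of `Φᵢ`, tested against a vector of the wandering subspace. -/
theorem hasSum_inner_multiplier (i : Fin n) (z : Complex.UnitDisc) (x y : S.wandering) :
    HasSum (fun k : ℕ => (z : ℂ) ^ k * inner ℂ ((S.shift ^ k) (y : S.toSubmodule))
      (S.restrictMκ i (x : S.toSubmodule))) (inner ℂ y (S.multiplier i z x)) := by
  have e : inner ℂ y (S.multiplier i z x) = inner ℂ (y : S.toSubmodule)
      (Ring.inverse (1 - (z : ℂ) • S.compressMzAdjoint)
        (S.restrictMκ i (x : S.toSubmodule))) := by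
    change inner ℂ y (S.wandering.orthogonalProjectionOnto _) = _
    rw [Submodule.inner_orthogonalProjectionOnto_eq_of_mem_left]
    rfl
  rw [e]
  simp only [← inner_compressMzAdjoint_pow]
  exact hasSum_inner_inverse_one_sub_smul _ S.norm_compressMzAdjoint_le _ _ _

variable {F : Type*} [NormedAddCommGroup F] [InnerProductSpace ℂ F]
variable {S} {T : InvariantSubspace n F}

theorem intertwines_multiplier_iff (τ : S.wandering ≃ₗᵢ[ℂ] T.wandering) (i : Fin n)
    (x : S.wandering) :
    (∀ z, τ (S.multiplier i z x) = T.multiplier i z (τ x)) ↔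
      ∀ (y : S.wandering) (k : ℕ),
        inner ℂ ((S.shift ^ k) (y : S.toSubmodule)) (S.restrictMκ i (x : S.toSubmodule)) =
          inner ℂ ((T.shift ^ k) (τ y : T.toSubmodule))
            (T.restrictMκ i (τ x : T.toSubmodule)) := by
  have hτ := inner_map_map_submodule τ
  constructor
  · intro h y
    refine congrFun (eq_of_hasSum_pow_mul
      (b := fun k => inner ℂ ((T.shift ^ k) (τ y : T.toSubmodule))
        (T.restrictMκ i (τ x : T.toSubmodule)))
      (fun z => S.hasSum_inner_multiplier i z x y) fun z => ?_)
    rw [← hτ, h z]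
    exact T.hasSum_inner_multiplier i z (τ x) (τ y)
  · intro h z
    refine ext_inner_left ℂ fun w => ?_
    obtain ⟨y, rfl⟩ := τ.surjective w
    rw [hτ]
    refine (S.hasSum_inner_multiplier i z x y).unique ?_
    simpa only [h y] using T.hasSum_inner_multiplier i z (τ x) (τ y)

/-! ### Unitary equivalence and coincidence -/

theorem map_shift_pow {U : S.toSubmodule ≃ₗᵢ[ℂ] T.toSubmodule}
    (hU : ∀ f, U (S.restrictMz f) = T.restrictMz (U f)) (k : ℕ) (f : S.toSubmodule) :
    U ((S.shift ^ k) f) = (T.shift ^ k) (U f) := by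
  induction k with
  | zero => rfl
  | succ k ih =>
    rw [pow_succ', pow_succ', LinearIsometry.coe_mul, LinearIsometry.coe_mul, Function.comp_apply,
      Function.comp_apply, ← ih]
    exact hU _

theorem map_wandering {U : S.toSubmodule ≃ₗᵢ[ℂ] T.toSubmodule}
    (hU : ∀ f, U (S.restrictMz f) = T.restrictMz (U f)) :
    S.wandering.map (U.toLinearEquiv : S.toSubmodule →ₗ[ℂ] T.toSubmodule) = T.wandering := by
  ext g
  obtain ⟨f, rfl⟩ := U.surjective g
  have h1 : U f ∈ S.wandering.map (U.toLinearEquiv : S.toSubmodule →ₗ[ℂ] T.toSubmodule) ↔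
      f ∈ S.wandering := by
    constructor
    · rintro ⟨f', hf', h⟩
      exact U.injective h ▸ hf'
    · exact fun h => ⟨f, h, rfl⟩
  rw [h1]
  simp only [wandering, Submodule.mem_orthogonal]
  constructor
  · rintro h _ ⟨g, rfl⟩
    obtain ⟨f', rfl⟩ := U.surjective g
    change inner ℂ (T.restrictMz (U f')) (U f) = 0
    rw [← hU, U.inner_map_map]
    exact h _ ⟨f', rfl⟩
  · rintro h _ ⟨f', rfl⟩
    change inner ℂ (S.restrictMz f') f = 0
    rw [← U.inner_map_map, hU]
    exact h _ ⟨U f', rfl⟩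

theorem UnitarilyEquivalent.coincide (h : S.UnitarilyEquivalent T) :
    Coincide (W := S.wandering) (W' := T.wandering) S.multiplier T.multiplier := by
  obtain ⟨U, hz, hκ⟩ := h
  let τ : S.wandering ≃ₗᵢ[ℂ] T.wandering :=
    (U.submoduleMap S.wandering).trans (LinearIsometryEquiv.ofEq _ _ (map_wandering hz))
  have hτ : ∀ x, (τ x : T.toSubmodule) = U x := fun x => rfl
  refine ⟨τ, fun i z x => (intertwines_multiplier_iff τ i x).2 (fun y k => ?_) z⟩
  rw [hτ, hτ, ← hκ, ← map_shift_pow hz, U.inner_map_map]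

theorem UnitarilyEquivalent.of_coincide
    (h : Coincide (W := S.wandering) (W' := T.wandering) S.multiplier T.multiplier) :
    S.UnitarilyEquivalent T := by
  obtain ⟨τ, hτ⟩ := h
  exact exists_linearIsometryEquiv_intertwining S.shift T.shift S.shift_pure T.shift_pure
    S.restrictMκ T.restrictMκ S.restrictMκ_shift_pow T.restrictMκ_shift_pow τ
    fun i x => (intertwines_multiplier_iff τ i x).1 fun z => hτ i z x

end InvariantSubspace

end PolydiscHardy

/-- Two invariant subspaces are unitarily equivalent if and only if their multiplier families
coincide. -/
theorem theorem6p1 (n : ℕ)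
    {E : Type*} [NormedAddCommGroup E] [InnerProductSpace ℂ E] [CompleteSpace E]
    {F : Type*} [NormedAddCommGroup F] [InnerProductSpace ℂ F] [CompleteSpace F]
    (S : PolydiscHardy.InvariantSubspace n E) (T : PolydiscHardy.InvariantSubspace n F) :
    S.UnitarilyEquivalent T ↔
      PolydiscHardy.Coincide (W := S.wandering) (W' := T.wandering) S.multiplier T.multiplier :=
  ⟨fun h => h.coincide, PolydiscHardy.InvariantSubspace.UnitarilyEquivalent.of_coincide⟩
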